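/- There is a function $f:(0,\infty)\to(0,\infty)$ with $f(\varepsilon)=\Theta(\varepsilon^2)$ as $\varepsilon\to0^+$ such that the following holds for every constant $\varepsilon>0$. An $(n,d,\lambda)$-graph is a $d$-regular graph on $n$ vertices in which all eigenvalues of the adjacency matrix (counted with multiplicity), except the largest one, are at most $\lambda$ in absolute value. Let $G$ be an $(n,d,\lambda)$-graph with $d\ge 1$ and $\lambda=o(d)$, where $n\to\infty$ (that is, consider any sequence of $(n_k,d_k,\lambda_k)$-graphs $G_k$ with $n_k\to\infty$, $d_k\ge1$ and $\lambda_k/d_k\to0$), and let $p=\frac{1+\varepsilon}{d}$, which is at most $1$ for all large $k$. Let $G_p$ be the random subgraph of $G$ in which every edge of $G$ is kept independently with probability $p$. Then, with probability tending to $1$, $G_p$ contains a path of length $\lceil f(\varepsilon)n\rceil$ (counted in edges). In particular, with probability tending to $1$, $G_p$ contains a path of length $\Theta(\varepsilon^2)n$. -/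

import Mathlib

open Filter Topology Asymptotics MeasureTheory

namespace PseudoRandom

open Classical in
/-- `G` is an `(n, d, lam)`-graph: a `d`-regular graph on `n` vertices in which all eigenvalues of
the adjacency matrix but the first one are at most `lam` in absolute value. The eigenvalues
`eigenvalues₀` are listed with multiplicity, in decreasing order, from index `0` on. -/
structure IsNDLambdaGraph {V : Type*} [Fintype V] [DecidableEq V] (G : SimpleGraph V)
    (n d : ℕ) (lam : ℝ) : Prop where
  card_eq : Fintype.card V = n
  regular : G.IsRegularOfDegree d
  abs_eigenvalue_le : ∀ i : Fin (Fintype.card V), 0 < (i : ℕ) →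
    |(G.isHermitian_adjMatrix ℝ).eigenvalues₀ i| ≤ lam

/-- The law of the random subgraph `G_p` of `G`: all the vertices are kept, and every edge of `G` is
kept independently with probability `p`. -/
noncomputable def randomSubgraph {V : Type*} (G : SimpleGraph V) (p : unitInterval) :
    Measure (SimpleGraph V) :=
  (ProbabilityTheory.setBernoulli G.edgeSet p).map SimpleGraph.fromEdgeSet

/-- `H` contains a path with exactly `l` edges. -/
def HasPathOfLength {V : Type*} (H : SimpleGraph V) (l : ℕ) : Prop :=
  ∃ (u v : V) (w : H.Walk u v), w.IsPath ∧ w.length = l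

end PseudoRandom

/-!
Explore the random subgraph by depth-first search, exposing an edge of `G` only when the search
asks for it. The stack of the search is always a path of open edges, and all edges of `G` between
the set `S` of finished vertices and the set `T` of unvisited ones have been exposed. Put
`e = min ε (1 / 10)` and stop when `s ≈ (e / 2 + 3 * e ^ 2 / 8) * n` vertices have been visited.
Every open exposed edge visits a new vertex, and a set of `N₀ ≈ e * d * n / 2` exposed edges
contains about `p * N₀ ≥ (e / 2 + e ^ 2 / 2) * n > s` open ones, so that with probability close
to `1` at most `N₀` edges have been exposed by then. If moreover the stack had at most
`l ≈ e ^ 2 / 20 * n` vertices, then `S` would have at least `s - l` vertices, and by the expander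
mixing lemma there would be about `d / n * (s - l) * (n - s) > N₀` edges between `S` and `T`, all
of them exposed: a contradiction.

The expander mixing lemma is `PseudoRandom.IsNDLambdaGraph.mul_card_mul_card_le`. The search is not
modelled as a process: `bernoulliMean_noPath_le_of_search` is an induction over the states of the
search, which bounds the probability, over the edges not yet exposed, that no path of length `l`
appears. The bound obeys the recursion of the exponential Markov bound for a binomial variable, so
that neither conditioning on histories nor a concentration inequality is needed. The numerical
estimates are `PseudoRandom.IsNDLambdaGraph.lt_card_interedges` and `pow_mul_pow_le_exp`.
-/

/-! ### The expander mixing lemma -/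

open scoped InnerProductSpace in
/-- A symmetric operator whose eigenvalues other than the one at `i₀` are at most `lam` in absolute
value acts, up to `lam`, as `d` times the orthogonal projection to any eigenvector `e` of eigenvalue
`d > lam`. The inequality is multiplied by `‖e‖ ^ 2` to avoid division. -/
theorem LinearMap.IsSymmetric.abs_inner_sub_le_of_spectral_gap {ι E : Type*} [Fintype ι]
    [NormedAddCommGroup E] [InnerProductSpace ℝ E] {T : E →ₗ[ℝ] E} (hT : T.IsSymmetric)
    (b : OrthonormalBasis ι ℝ E) (μ : ι → ℝ) (hb : ∀ i, T (b i) = μ i • b i) {i₀ : ι} {lam d : ℝ}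
    (hlam : 0 ≤ lam) (hμ : ∀ i, i ≠ i₀ → |μ i| ≤ lam) (hd : lam < d) {e : E} (he : T e = d • e)
    (x y : E) :
    |‖e‖ ^ 2 * ⟪x, T y⟫_ℝ - d * (⟪x, e⟫_ℝ * ⟪e, y⟫_ℝ)| ≤ ‖e‖ ^ 2 * (lam * (‖x‖ * ‖y‖)) := by
  classical
  have hmul (i) (z : E) : ⟪b i, T z⟫_ℝ = μ i * ⟪b i, z⟫_ℝ := by
    rw [← hT, hb, real_inner_smul_left]
  have hcoef (i) : (d - μ i) * ⟪b i, e⟫_ℝ = 0 := by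
    have h := hmul i e
    rw [he, real_inner_smul_right] at h
    linarith
  have horth (i) (hi : i ≠ i₀) : ⟪b i, e⟫_ℝ = 0 := by
    rcases mul_eq_zero.1 (hcoef i) with h | h
    · linarith [le_abs_self (μ i), hμ i hi]
    · exact h
  have hexp (u v : E) : ⟪u, v⟫_ℝ = ∑ i, ⟪u, b i⟫_ℝ * ⟪b i, v⟫_ℝ := (b.sum_inner_mul_inner u v).symm
  have hproj (z : E) : ⟪z, e⟫_ℝ = ⟪z, b i₀⟫_ℝ * ⟪b i₀, e⟫_ℝ := by
    rw [hexp, Finset.sum_eq_single i₀ (fun i _ hi ↦ by rw [horth i hi, mul_zero]) (by simp)]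
  have hnorm : ‖e‖ ^ 2 = ⟪b i₀, e⟫_ℝ ^ 2 := by
    rw [← real_inner_self_eq_norm_sq, hproj e, real_inner_comm, sq]
  have hsplit : ‖e‖ ^ 2 * ⟪x, T y⟫_ℝ - d * (⟪x, e⟫_ℝ * ⟪e, y⟫_ℝ) =
      ‖e‖ ^ 2 * ∑ i ∈ Finset.univ.erase i₀, μ i * (⟪x, b i⟫_ℝ * ⟪b i, y⟫_ℝ) := by
    rw [hexp x (T y), ← Finset.add_sum_erase _ _ (Finset.mem_univ i₀), real_inner_comm y e,
      hproj x, hproj y, hmul, real_inner_comm (b i₀) y, hnorm]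
    simp only [hmul]
    rw [Finset.sum_congr rfl fun i _ ↦
      (mul_left_comm (⟪x, b i⟫_ℝ) (μ i) (⟪b i, y⟫_ℝ))]
    linear_combination -(⟪x, b i₀⟫_ℝ * ⟪b i₀, y⟫_ℝ * ⟪b i₀, e⟫_ℝ) * hcoef i₀
  rw [hsplit, abs_mul, abs_of_nonneg (sq_nonneg _)]
  refine mul_le_mul_of_nonneg_left ?_ (sq_nonneg _)
  have hparseval (z : E) : ∑ i, |⟪z, b i⟫_ℝ| ^ 2 = ‖z‖ ^ 2 := by
    rw [← real_inner_self_eq_norm_sq, hexp z z]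
    exact Finset.sum_congr rfl fun i _ ↦ by rw [sq_abs, sq, real_inner_comm z (b i)]
  calc |∑ i ∈ Finset.univ.erase i₀, μ i * (⟪x, b i⟫_ℝ * ⟪b i, y⟫_ℝ)|
      ≤ ∑ i ∈ Finset.univ.erase i₀, lam * (|⟪x, b i⟫_ℝ| * |⟪y, b i⟫_ℝ|) := by
        refine (Finset.abs_sum_le_sum_abs _ _).trans (Finset.sum_le_sum fun i hi ↦ ?_)
        rw [abs_mul, abs_mul, real_inner_comm y (b i)]
        exact mul_le_mul_of_nonneg_right (hμ i (Finset.ne_of_mem_erase hi)) (by positivity)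
    _ ≤ ∑ i, lam * (|⟪x, b i⟫_ℝ| * |⟪y, b i⟫_ℝ|) :=
        Finset.sum_le_sum_of_subset_of_nonneg (Finset.erase_subset _ _)
          fun _ _ _ ↦ by positivity
    _ ≤ lam * (‖x‖ * ‖y‖) := by
        rw [← Finset.mul_sum]
        refine mul_le_mul_of_nonneg_left ?_ hlam
        refine (Real.sum_mul_le_sqrt_mul_sqrt _ _ _).trans_eq ?_
        rw [hparseval, hparseval, Real.sqrt_sq (norm_nonneg _), Real.sqrt_sq (norm_nonneg _)]

open Classical in
/-- The lower bound of the expander mixing lemma. The error `lam * √(#S * #T)` of the usual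
statement is bounded by `lam * n`, and everything is multiplied by `n`. -/
theorem PseudoRandom.IsNDLambdaGraph.mul_card_mul_card_le {V : Type*} [Fintype V] [DecidableEq V]
    {G : SimpleGraph V} {n d : ℕ} {lam : ℝ} (h : PseudoRandom.IsNDLambdaGraph G n d lam)
    (hn : 0 < n) (hd : |lam| < d) (S T : Finset V) :
    (d : ℝ) * (S.card * T.card) ≤ n * ((G.interedges S T).card + |lam| * n) := by
  have hcard := h.card_eq
  set A := G.adjMatrix ℝ with hA
  have hH : A.IsHermitian := G.isHermitian_adjMatrix ℝ
  let eq : Fin (Fintype.card V) ≃ V := Fintype.equivOfCardEq (Fintype.card_fin _)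
  have hpos : 0 < Fintype.card V := by omega
  let χ (S : Finset V) : EuclideanSpace ℝ V := WithLp.toLp 2 fun v ↦ if v ∈ S then 1 else 0
  have hχ (S T : Finset V) : inner ℝ (χ S) (χ T) = ((S ∩ T).card : ℝ) := by
    simp [χ, PiLp.inner_apply, ← ite_and, Finset.filter_and]
  have hχn (S : Finset V) : ‖χ S‖ ^ 2 = (S.card : ℝ) := by
    rw [← real_inner_self_eq_norm_sq, hχ, Finset.inter_self]
  have hreg : ∀ v, G.degree v = d := fun v ↦ by
    convert h.regular v
  have hmix := (Matrix.isSymmetric_toEuclideanLin_iff.mpr hH).abs_inner_sub_le_of_spectral_gap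
    hH.eigenvectorBasis hH.eigenvalues (i₀ := eq ⟨0, hpos⟩) (lam := |lam|) (d := d)
    (e := χ Finset.univ) (fun i ↦ by
      ext1 v
      exact congrFun (hH.mulVec_eigenvectorBasis i) v)
    (abs_nonneg _)
    (fun i hi ↦ by
      refine le_trans ?_ (le_abs_self lam)
      refine h.abs_eigenvalue_le (eq.symm i) (Nat.pos_of_ne_zero fun h0 ↦ hi ?_)
      rw [← eq.symm_apply_eq]
      exact Fin.ext h0) hd (by
      ext1 v
      simp [χ, hA, ← hreg v, Matrix.mulVec, dotProduct, SimpleGraph.adjMatrix_apply,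
        ← SimpleGraph.card_neighborFinset_eq_degree, SimpleGraph.neighborFinset_eq_filter])
    (χ S) (χ T)
  have hinner : inner ℝ (χ S) (Matrix.toEuclideanLin A (χ T)) = ((G.interedges S T).card : ℝ) := by
    simp only [SimpleGraph.interedges_def, Finset.card_filter, Finset.sum_product, χ,
      PiLp.inner_apply, hA, Matrix.toLpLin_apply, Matrix.mulVec, dotProduct,
      SimpleGraph.adjMatrix_apply]
    simp
  rw [hinner, hχn, hχ, hχ, Finset.inter_univ, Finset.univ_inter, Finset.card_univ, hcard] at hmix
  have hle (S : Finset V) : ‖χ S‖ ≤ √n := by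
    rw [← Real.sqrt_sq (norm_nonneg (χ S)), hχn]
    refine Real.sqrt_le_sqrt ?_
    exact_mod_cast hcard ▸ S.card_le_univ
  have hprod : ‖χ S‖ * ‖χ T‖ ≤ n := by
    calc _ ≤ √n * √n := mul_le_mul (hle S) (hle T) (norm_nonneg _) (Real.sqrt_nonneg _)
      _ = n := Real.mul_self_sqrt (Nat.cast_nonneg _)
  have h1 : (n : ℝ) * (|lam| * (‖χ S‖ * ‖χ T‖)) ≤ n * (|lam| * n) := by gcongr
  linarith [(abs_le.1 hmix).1]

/-! ### Paths from lists of vertices -/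

theorem PseudoRandom.HasPathOfLength.mono_length {V : Type*} {H : SimpleGraph V} {k l : ℕ}
    (h : PseudoRandom.HasPathOfLength H l) (hkl : k ≤ l) : PseudoRandom.HasPathOfLength H k := by
  obtain ⟨u, v, w, hw, rfl⟩ := h
  exact ⟨u, _, w.take k, hw.take k, by simp [hkl]⟩

theorem SimpleGraph.exists_isPath_of_isChain {V : Type*} {H : SimpleGraph V} (u : V) (L : List V)
    (hchain : (u :: L).IsChain H.Adj) (hnodup : (u :: L).Nodup) :
    ∃ (v : V) (w : H.Walk u v), w.IsPath ∧ w.support = u :: L := by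
  induction L generalizing u with
  | nil => exact ⟨u, .nil, by simp, by simp⟩
  | cons a L ih =>
    obtain ⟨v, w, -, hsupp⟩ := ih a hchain.tail hnodup.tail
    refine ⟨v, .cons (List.isChain_cons_cons.1 hchain).1 w, ?_, by simp [hsupp]⟩
    rw [SimpleGraph.Walk.isPath_def]
    simpa [hsupp] using hnodup

theorem PseudoRandom.HasPathOfLength.of_isChain {V : Type*} {H : SimpleGraph V} {U : List V} {l : ℕ}
    (hchain : U.IsChain H.Adj) (hnodup : U.Nodup) (hl : l < U.length) :
    PseudoRandom.HasPathOfLength H l := by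
  cases U with
  | nil => simp at hl
  | cons u L =>
    obtain ⟨v, w, hw, hsupp⟩ := SimpleGraph.exists_isPath_of_isChain u L hchain hnodup
    have hlen := congrArg List.length hsupp
    rw [SimpleGraph.Walk.length_support] at hlen
    exact PseudoRandom.HasPathOfLength.mono_length ⟨u, v, w, hw, rfl⟩ (by omega)

/-! ### Random subsets of a finite set -/

/-- The expectation of `F B`, where `B` is a random subset of `R` that contains each element
independently with probability `p`. -/
noncomputable def bernoulliMean {α : Type*} (p : ℝ) (R : Finset α) (F : Finset α → ℝ) : ℝ :=
  ∑ B ∈ R.powerset, p ^ B.card * (1 - p) ^ (R.card - B.card) * F B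

/-- Conditioning on whether a given element is chosen. -/
theorem bernoulliMean_insert {α : Type*} [DecidableEq α] (p : ℝ) {R : Finset α} {e : α}
    (he : e ∉ R) (F : Finset α → ℝ) :
    bernoulliMean p (insert e R) F =
      p * bernoulliMean p R (fun B ↦ F (insert e B)) + (1 - p) * bernoulliMean p R F := by
  rw [bernoulliMean, Finset.sum_powerset_insert he, add_comm, bernoulliMean, bernoulliMean,
    Finset.mul_sum, Finset.mul_sum]
  congr 1 <;> refine Finset.sum_congr rfl fun B hB ↦ ?_
  · have hB' := Finset.mem_powerset.1 hB
    rw [Finset.card_insert_of_notMem he, Finset.card_insert_of_notMem fun h ↦ he (hB' h),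
      Nat.add_sub_add_right]
    ring
  · have := Finset.card_le_card (Finset.mem_powerset.1 hB)
    rw [Finset.card_insert_of_notMem he, Nat.sub_add_comm this]
    ring

theorem bernoulliMean_le_one {α : Type*} {p : ℝ} (h0 : 0 ≤ p) (h1 : p ≤ 1) (R : Finset α)
    {F : Finset α → ℝ} (hF : ∀ B, F B ≤ 1) : bernoulliMean p R F ≤ 1 := by
  have h1' : 0 ≤ 1 - p := by linarith
  calc bernoulliMean p R F ≤ ∑ B ∈ R.powerset, p ^ B.card * (1 - p) ^ (R.card - B.card) :=
        Finset.sum_le_sum fun B _ ↦ mul_le_of_le_one_right (by positivity) (hF B)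
    _ = 1 := by rw [Finset.sum_pow_mul_eq_add_pow]; simp

theorem bernoulliMean_eq_zero {α : Type*} (p : ℝ) (R : Finset α) {F : Finset α → ℝ}
    (hF : ∀ B, F B = 0) : bernoulliMean p R F = 0 := by
  simp [bernoulliMean, hF]

/-! ### Depth-first search -/

/-- In a graph on vertex set `V` with edge set `B`, the indicator of having no path of length `l`. -/
noncomputable def noPathIndicator {V : Type*} (l : ℕ) (B : Finset (Sym2 V)) : ℝ :=
  open Classical in
  if PseudoRandom.HasPathOfLength (SimpleGraph.fromEdgeSet (B : Set (Sym2 V))) l then 0 else 1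

theorem noPathIndicator_le_one {V : Type*} (l : ℕ) (B : Finset (Sym2 V)) :
    noPathIndicator l B ≤ 1 := by
  unfold noPathIndicator; split_ifs <;> norm_num

open Classical in
/-- `SimpleGraph.interedges` counts ordered pairs; disjointness makes `(s, t) ↦ s(s, t)` injective
on them. -/
theorem SimpleGraph.card_interedges_le_of_disjoint {V : Type*} [Fintype V]
    (G : SimpleGraph V) {S T : Finset V} (hST : Disjoint S T) {Q : Finset (Sym2 V)}
    (hQ : ∀ s ∈ S, ∀ t ∈ T, G.Adj s t → s(s, t) ∈ Q) :
    (G.interedges S T).card ≤ Q.card := by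
  refine Finset.card_le_card_of_injOn (fun x ↦ s(x.1, x.2)) ?_ ?_
  · rintro ⟨a, b⟩ hab
    rw [Finset.mem_coe, SimpleGraph.mem_interedges_iff] at hab
    exact hQ a hab.1 b hab.2.1 hab.2.2
  · rintro ⟨a, b⟩ hab ⟨c, e⟩ hce heq
    rw [Finset.mem_coe, SimpleGraph.mem_interedges_iff] at hab hce
    rcases Sym2.eq_iff.1 heq with h | h
    · exact Prod.ext h.1 h.2
    · exact absurd h.1 (fun h' : a = e ↦ Finset.disjoint_left.1 hST hab.1 (h' ▸ hce.2.1))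

open Classical in
/-- Depth-first search from a state with stack `U` (the top vertex first), unvisited vertices `T`,
exposed open edges `A` and unexposed edges `R`, when `N` more edges may be exposed and `j` more
vertices have to be visited. The remaining vertices are the finished ones, and the invariant
`hfin` says that every edge from a finished vertex to `T` has been exposed.

If `j = 0` then the finished set and `T` violate `hG` unless the stack is longer than `l`. Otherwise
a step of the search either is free or exposes one edge, which is open with probability `p` and then
lowers `j` by one; the bound `w ^ j * (1 - p + p / w) ^ N` is the exponential Markov bound for the
event that fewer than `j` of `N` independent trials succeed, and satisfies the same recursion. -/
theorem bernoulliMean_noPath_le_of_search {V : Type*} [Fintype V] (G : SimpleGraph V)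
    {l s N₀ : ℕ} {p w : ℝ} (hp0 : 0 ≤ p) (hp1 : p ≤ 1) (hw : 1 ≤ w)
    (hs : s ≤ Fintype.card V)
    (hG : ∀ S T : Finset V, Disjoint S T → s ≤ S.card + l → T.card + s = Fintype.card V →
      N₀ < (G.interedges S T).card)
    (m : ℕ) (U : List V) (T : Finset V) (A R : Finset (Sym2 V)) (j N : ℕ)
    (hm : 2 * T.card + R.card + U.length < m)
    (hR : R ⊆ G.edgeFinset) (hN : N + G.edgeFinset.card = N₀ + R.card)
    (hj : T.card + s = Fintype.card V + j)
    (hchain : U.IsChain (SimpleGraph.fromEdgeSet (A : Set (Sym2 V))).Adj) (hnodup : U.Nodup)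
    (hUT : ∀ u ∈ U, u ∉ T)
    (hfin : ∀ v, v ∉ U → v ∉ T → ∀ t ∈ T, s(v, t) ∉ R) :
    bernoulliMean p R (fun B ↦ noPathIndicator l (A ∪ B)) ≤ w ^ j * (1 - p + p / w) ^ N := by
  have hw0 : 0 < w := by linarith
  have hc0 : 0 ≤ 1 - p + p / w := by
    have : 0 ≤ p / w := by positivity
    linarith
  have hmono {A A' : Finset (Sym2 V)} (h : A ⊆ A') : SimpleGraph.fromEdgeSet (A : Set (Sym2 V)) ≤
      SimpleGraph.fromEdgeSet (A' : Set (Sym2 V)) :=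
    SimpleGraph.fromEdgeSet_mono (by exact_mod_cast h)
  induction m generalizing U T A R j N with
  | zero => omega
  | succ m ih =>
  rcases Nat.eq_zero_or_pos j with rfl | hjpos
  · rw [bernoulliMean_eq_zero]
    · positivity
    intro B
    rw [noPathIndicator, if_pos]
    refine PseudoRandom.HasPathOfLength.of_isChain
      (hchain.imp fun _ _ h ↦ hmono Finset.subset_union_left h) hnodup ?_
    by_contra! hshort
    have hUTd : Disjoint U.toFinset T :=
      Finset.disjoint_left.2 fun u hu ↦ hUT u (List.mem_toFinset.1 hu)
    have hcompl := Finset.card_compl_add_card (U.toFinset ∪ T)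
    rw [Finset.card_union_of_disjoint hUTd, List.toFinset_card_of_nodup hnodup] at hcompl
    have hST : Disjoint (U.toFinset ∪ T)ᶜ T :=
      disjoint_compl_left.mono_right Finset.subset_union_right
    have hmany := hG _ T hST (by omega) (by omega)
    have hfew := G.card_interedges_le_of_disjoint hST (Q := G.edgeFinset \ R) (by
      intro v hv t ht hadj
      simp only [Finset.mem_compl, Finset.mem_union, List.mem_toFinset, not_or] at hv
      exact Finset.mem_sdiff.2 ⟨SimpleGraph.mem_edgeFinset.2 hadj, hfin v hv.1 hv.2 t ht⟩)
    rw [Finset.card_sdiff_of_subset hR] at hfew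
    omega
  rcases Nat.eq_zero_or_pos N with rfl | hNpos
  · rw [pow_zero, mul_one]
    exact (bernoulliMean_le_one hp0 hp1 R fun B ↦ noPathIndicator_le_one l _).trans
      (one_le_pow₀ hw)
  obtain ⟨j, rfl⟩ := Nat.exists_eq_succ_of_ne_zero hjpos.ne'
  obtain ⟨N, rfl⟩ := Nat.exists_eq_succ_of_ne_zero hNpos.ne'
  cases U with
  | nil =>
    -- The stack is empty: an arbitrary unvisited vertex starts a new component.
    obtain ⟨t, ht⟩ : T.Nonempty := Finset.card_pos.1 (by omega)
    have hcard := Finset.card_erase_add_one ht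
    refine (ih [t] (T.erase t) A R j (N + 1) ?_ hR hN (by omega) (by simp) (by simp) (by simp)
      fun v hv hvT x hx ↦ ?_).trans ?_
    · simp only [List.length_singleton, List.length_nil] at hm ⊢
      omega
    · rw [List.mem_singleton] at hv
      exact hfin v (by simp) (fun h ↦ hvT (Finset.mem_erase.2 ⟨hv, h⟩)) x
        (Finset.mem_of_mem_erase hx)
    · exact mul_le_mul_of_nonneg_right (pow_le_pow_right₀ hw (Nat.le_succ j)) (by positivity)
  | cons u L =>
    rw [List.length_cons] at hm
    by_cases hq : ∃ t ∈ T, s(u, t) ∈ R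
    · -- Expose an edge from the top of the stack to `T`.
      obtain ⟨t, ht, he⟩ := hq
      set R' := R.erase s(u, t) with hR'
      have heR' : s(u, t) ∉ R' := Finset.notMem_erase _ _
      have hRcard : R'.card + 1 = R.card := Finset.card_erase_add_one he
      have hsub : R' ⊆ R := Finset.erase_subset _ _
      have hcard := Finset.card_erase_add_one ht
      have htU : t ∉ u :: L := fun h ↦ hUT t h ht
      have hclosed : bernoulliMean p R' (fun B ↦ noPathIndicator l (A ∪ B)) ≤
          w ^ (j + 1) * (1 - p + p / w) ^ N :=
        ih (u :: L) T A R' (j + 1) N (by rw [List.length_cons]; omega) (hsub.trans hR) (by omega) hj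
          hchain hnodup hUT fun v hv hvT x hx h ↦ hfin v hv hvT x hx (hsub h)
      have hopen : bernoulliMean p R' (fun B ↦ noPathIndicator l (A ∪ insert s(u, t) B)) ≤
          w ^ j * (1 - p + p / w) ^ N := by
        simp only [Finset.union_insert, ← Finset.insert_union]
        refine ih (t :: u :: L) (T.erase t) (insert s(u, t) A) R' j N
          (by simp only [List.length_cons]; omega) (hsub.trans hR) (by omega) (by omega)
          (List.isChain_cons_cons.2 ⟨?_, hchain.imp fun _ _ h ↦
            hmono (Finset.subset_insert _ _) h⟩)
          (List.nodup_cons.2 ⟨htU, hnodup⟩) ?_ fun v hv hvT x hx h ↦ ?_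
        · rw [SimpleGraph.fromEdgeSet_adj]
          exact ⟨by simp [Sym2.eq_swap], fun h ↦ htU (by simp [h])⟩
        · intro v hv hvT
          rcases List.mem_cons.1 hv with rfl | hv
          · exact Finset.notMem_erase _ _ hvT
          · exact hUT v hv (Finset.mem_of_mem_erase hvT)
        · rw [List.mem_cons, not_or] at hv
          exact hfin v hv.2 (fun h' ↦ hvT (Finset.mem_erase.2 ⟨hv.1, h'⟩)) x
            (Finset.mem_of_mem_erase hx) (hsub h)
      rw [← Finset.insert_erase he, ← hR', bernoulliMean_insert p heR']
      have hwc : w * (1 - p + p / w) = (1 - p) * w + p := by field_simp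
      calc _ ≤ p * (w ^ j * (1 - p + p / w) ^ N) +
            (1 - p) * (w ^ (j + 1) * (1 - p + p / w) ^ N) :=
          add_le_add (mul_le_mul_of_nonneg_left hopen hp0)
            (mul_le_mul_of_nonneg_left hclosed (by linarith))
        _ = w ^ (j + 1) * (1 - p + p / w) ^ (N + 1) := by
          linear_combination -(w ^ j * (1 - p + p / w) ^ N) * hwc
    · -- All edges from the top of the stack to `T` have been exposed, so it is finished.
      push Not at hq
      refine ih L T A R (j + 1) (N + 1) (by omega) hR hN hj hchain.tail hnodup.tail
        (fun v hv ↦ hUT v (List.mem_cons_of_mem _ hv)) fun v hv hvT x hx ↦ ?_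
      by_cases hvu : v = u
      · exact hvu ▸ hq x hx
      · exact hfin v (by simp [hvu, hv]) hvT x hx

/-! ### The law of the random subgraph -/

theorem SimpleGraph.measurableSet_of_finite {V : Type*} [Finite V] (s : Set (SimpleGraph V)) :
    MeasurableSet s := by
  rw [← s.preimage_image_eq SimpleGraph.edgeSet_injective]
  exact SimpleGraph.measurable_edgeSet (Set.toFinite _).measurableSet

instance {V : Type*} (G : SimpleGraph V) (p : unitInterval) :
    IsProbabilityMeasure (PseudoRandom.randomSubgraph G p) :=
  Measure.isProbabilityMeasure_map SimpleGraph.measurable_fromEdgeSet.aemeasurable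

open Classical in
/-- The probability that the random subgraph has no path of length `l`, as a finite sum. -/
theorem randomSubgraph_real_noPath {V : Type*} [Fintype V] (G : SimpleGraph V) (p : unitInterval)
    (l : ℕ) :
    (PseudoRandom.randomSubgraph G p).real {H | ¬ PseudoRandom.HasPathOfLength H l} =
      bernoulliMean p G.edgeFinset (noPathIndicator l) := by
  rw [PseudoRandom.randomSubgraph,
    map_measureReal_apply SimpleGraph.measurable_fromEdgeSet (SimpleGraph.measurableSet_of_finite _),
    measureReal_def,
    ProbabilityTheory.setBernoulli_apply_eq_apply_subsets, ← measureReal_def]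
  have hset : {B : Set (Sym2 V) | B ∈ SimpleGraph.fromEdgeSet ⁻¹'
      {H : SimpleGraph V | ¬ PseudoRandom.HasPathOfLength H l} ∧ B ⊆ G.edgeSet} =
      ((G.edgeFinset.powerset.filter fun B : Finset (Sym2 V) ↦
        ¬ PseudoRandom.HasPathOfLength (SimpleGraph.fromEdgeSet (B : Set (Sym2 V))) l).image
          fun B : Finset (Sym2 V) ↦ (B : Set (Sym2 V)) : Finset (Set (Sym2 V))) := by
    ext B
    simp only [Set.mem_ofPred_eq, Set.mem_preimage, Finset.coe_image, Set.mem_image,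
      Finset.mem_coe, Finset.mem_filter, Finset.mem_powerset]
    constructor
    · rintro ⟨h, hB⟩
      exact ⟨B.toFinset, ⟨fun e he ↦ by simpa using hB (by simpa using he), by simpa using h⟩,
        by simp⟩
    · rintro ⟨B, ⟨hB, h⟩, rfl⟩
      exact ⟨h, fun e he ↦ SimpleGraph.mem_edgeFinset.1 (hB (by simpa using he))⟩
  rw [hset, ← sum_measureReal_singleton, Finset.sum_image (by simp), Finset.sum_filter,
    bernoulliMean]
  refine Finset.sum_congr rfl fun B hB ↦ ?_
  have hB := Finset.mem_powerset.1 hB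
  rw [noPathIndicator, ite_not]
  split_ifs with h
  · rw [mul_zero]
  · have hsub : (B : Set (Sym2 V)) ⊆ G.edgeSet := fun e he ↦
      SimpleGraph.mem_edgeFinset.1 (hB (by simpa using he))
    rw [ProbabilityTheory.setBernoulli_real_singleton p hsub (Set.toFinite _), mul_one,
      Set.ncard_sdiff hsub, Set.ncard_coe_finset, ← SimpleGraph.coe_edgeFinset,
      Set.ncard_coe_finset]

open Classical in
/-- If any disjoint `S` and `T` with `s - l` and `n - s` vertices span more than `N₀` edges, then a
search that visits `s` vertices without building a path of length `l` has exposed more than `N₀`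
edges, fewer than `s` of which are open; the bound is the exponential Markov bound for that. -/
theorem randomSubgraph_real_noPath_le {V : Type*} [Fintype V] (G : SimpleGraph V)
    (p : unitInterval) {l s N₀ : ℕ} {w : ℝ} (hw : 1 ≤ w) (hs : s ≤ Fintype.card V)
    (hG : ∀ S T : Finset V, Disjoint S T → s ≤ S.card + l → T.card + s = Fintype.card V →
      N₀ < (G.interedges S T).card) :
    (PseudoRandom.randomSubgraph G p).real {H | ¬ PseudoRandom.HasPathOfLength H l} ≤
      w ^ s * (1 - p + p / w) ^ N₀ := by
  rw [randomSubgraph_real_noPath]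
  simpa using bernoulliMean_noPath_le_of_search G p.2.1 p.2.2 hw hs hG _ [] Finset.univ ∅
    G.edgeFinset s N₀ (Nat.lt_succ_self _) le_rfl rfl (by simp) (by simp) (by simp) (by simp)
    (by simp)

/-! ### Numerical estimates and conclusion -/

open Classical in
/-- For small `e`, once `s ≈ (e / 2 + 3 * e ^ 2 / 8) * n` vertices have been visited and all but
`l ≈ e ^ 2 / 20 * n` of them are finished, there are more than `e * d * n / 2` edges from the
finished to the unvisited vertices: their number is about `d * n * x * (1 - y)` with
`y = e / 2 + 3 * e ^ 2 / 8` and `x = y - e ^ 2 / 20`, and `x * (1 - y) > e / 2`. -/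
theorem PseudoRandom.IsNDLambdaGraph.lt_card_interedges {V : Type*} [Fintype V] [DecidableEq V]
    {G : SimpleGraph V} {n d : ℕ} {lam e : ℝ} (h : PseudoRandom.IsNDLambdaGraph G n d lam)
    (he0 : 0 < e) (he1 : e ≤ 1 / 10) (hd : 0 < d) (hlam : |lam| ≤ e ^ 2 / 100 * d)
    (hn : 100 ≤ e ^ 2 * n) (S T : Finset V)
    (hS : ⌈(e / 2 + 3 * e ^ 2 / 8) * n⌉₊ ≤ S.card + ⌈e ^ 2 / 20 * n⌉₊)
    (hT : T.card + ⌈(e / 2 + 3 * e ^ 2 / 8) * n⌉₊ = n) :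
    ⌊e * d * n / 2⌋₊ < (G.interedges S T).card := by
  have hd' : (0 : ℝ) < d := by exact_mod_cast hd
  have hn0 : (0 : ℝ) < n := by
    by_contra! hneg
    nlinarith [sq_nonneg e]
  have hsq : e ^ 2 ≤ e / 10 := by nlinarith
  by_contra! hfew
  have hI : ((G.interedges S T).card : ℝ) ≤ e * d * n / 2 :=
    (Nat.cast_le.2 hfew).trans (Nat.floor_le (by positivity))
  have hmix := h.mul_card_mul_card_le (by exact_mod_cast hn0) (by nlinarith) S T
  have hs1 := Nat.le_ceil ((e / 2 + 3 * e ^ 2 / 8) * n)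
  have hs2 := Nat.ceil_lt_add_one (a := (e / 2 + 3 * e ^ 2 / 8) * n) (by positivity)
  have hl := Nat.ceil_lt_add_one (a := e ^ 2 / 20 * n) (by positivity)
  have hSr : ((⌈(e / 2 + 3 * e ^ 2 / 8) * n⌉₊ : ℕ) : ℝ) ≤ S.card + (⌈e ^ 2 / 20 * n⌉₊ : ℕ) := by
    exact_mod_cast hS
  have hTr : (T.card : ℝ) + (⌈(e / 2 + 3 * e ^ 2 / 8) * n⌉₊ : ℕ) = n := by exact_mod_cast hT
  set x := e / 2 + 3 * e ^ 2 / 8 - 6 * e ^ 2 / 100 with hx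
  set y := 1 - (e / 2 + 3 * e ^ 2 / 8) - e ^ 2 / 100 with hy
  have hx0 : 0 < x := by nlinarith
  have hy0 : 0 < y := by nlinarith
  have hSx : x * n ≤ S.card := by rw [hx]; linarith
  have hTy : y * n ≤ T.card := by rw [hy]; linarith
  have hprod : (x * n) * (y * n) ≤ S.card * T.card := by gcongr
  have hxy : e / 2 + e ^ 2 / 100 < x * y := by
    rw [hx, hy]
    nlinarith [pow_pos he0 2, pow_pos he0 3, pow_pos he0 4,
      mul_le_mul_of_nonneg_left he1 (pow_pos he0 2).le,
      mul_le_mul_of_nonneg_left he1 (pow_pos he0 3).le]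
  have hup : (d : ℝ) * (S.card * T.card) ≤ (d * n ^ 2) * (e / 2 + e ^ 2 / 100) := by
    refine hmix.trans ?_
    have : (n : ℝ) * ((G.interedges S T).card + |lam| * n) ≤
      n * (e * d * n / 2 + e ^ 2 / 100 * d * n) := by gcongr
    linarith
  have hlow : (d * n ^ 2 : ℝ) * (x * y) ≤ d * (S.card * T.card) := by
    calc _ = (d : ℝ) * ((x * n) * (y * n)) := by ring
      _ ≤ _ := by gcongr
  have : (d * n ^ 2 : ℝ) * (e / 2 + e ^ 2 / 100) < (d * n ^ 2 : ℝ) * (x * y) := by gcongr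
  linarith

/-- The exponential Markov bound is exponentially small: the expected number `p * N₀` of successes,
with `N₀ ≈ e * d * n / 2`, is about `(e / 2 + e ^ 2 / 2) * n`, and exceeds the threshold
`(e / 2 + 3 * e ^ 2 / 8) * n` by a factor of more than `w = 1 + e / 8`. -/
theorem pow_mul_pow_le_exp {n d : ℕ} {e p : ℝ} (he0 : 0 < e) (he1 : e ≤ 1 / 10) (hd : 0 < d)
    (hp1 : p ≤ 1) (hp : (1 + e) / d ≤ p) (hn : 100 ≤ e ^ 2 * n) :
    (1 + e / 8) ^ ⌈(e / 2 + 3 * e ^ 2 / 8) * n⌉₊ * (1 - p + p / (1 + e / 8)) ^ ⌊e * d * n / 2⌋₊ ≤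
      Real.exp (-(e ^ 3 / 450) * n) := by
  have hd' : (0 : ℝ) < d := by exact_mod_cast hd
  have hp0 : 0 < p := lt_of_lt_of_le (by positivity) hp
  set s := ⌈(e / 2 + 3 * e ^ 2 / 8) * n⌉₊ with hs
  set N := ⌊e * d * n / 2⌋₊ with hN
  set θ := e / 8 / (1 + e / 8) with hθ
  have hw : (0 : ℝ) < 1 + e / 8 := by positivity
  have hθw : θ * (1 + e / 8) = e / 8 := by rw [hθ]; field_simp
  have hc : 1 - p + p / (1 + e / 8) = 1 - p * θ := by rw [hθ]; field_simp; ring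
  have hc0 : 0 ≤ 1 - p + p / (1 + e / 8) := by
    have : 0 ≤ p / (1 + e / 8) := by positivity
    linarith
  have h1 : (1 + e / 8) ^ s ≤ Real.exp (s * (e / 8)) := by
    rw [Real.exp_nat_mul]
    exact pow_le_pow_left₀ hw.le (by linarith [Real.add_one_le_exp (e / 8)]) s
  have h2 : (1 - p + p / (1 + e / 8)) ^ N ≤ Real.exp (N * -(p * θ)) := by
    rw [Real.exp_nat_mul]
    exact pow_le_pow_left₀ hc0 (by linarith [Real.add_one_le_exp (-(p * θ))]) N
  refine (mul_le_mul h1 h2 (pow_nonneg hc0 _) (Real.exp_nonneg _)).trans ?_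
  rw [← Real.exp_add, Real.exp_le_exp]
  have hs2 : (s : ℝ) < (e / 2 + 3 * e ^ 2 / 8) * n + 1 := Nat.ceil_lt_add_one (by positivity)
  have hN2 : e * d * n / 2 < N + 1 := Nat.lt_floor_add_one _
  have hpd : 1 + e ≤ p * d := by rwa [div_le_iff₀ hd'] at hp
  have hpN : (1 + e) * (e * n / 2) - 1 ≤ p * N := by
    have a1 : (1 + e) * (e * n / 2) ≤ p * d * (e * n / 2) := by gcongr
    have a2 : p * (e * d * n / 2) ≤ p * (N + 1) := by gcongr
    linarith
  have hws : (1 + e / 8) * s ≤ (1 + e / 8) * ((e / 2 + 3 * e ^ 2 / 8) * n + 1) := by gcongr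
  have he3 : e ^ 3 * n ≤ 1 / 10 * (e ^ 2 * n) := by
    have : e * (e ^ 2 * n) ≤ 1 / 10 * (e ^ 2 * n) := by gcongr
    linarith
  have hgap : (1 + e / 8) * s - p * N ≤ -(e ^ 2 * n / 50) := by linarith
  have hθ9 : e / 9 ≤ θ := by
    rw [hθ, le_div_iff₀ hw]
    nlinarith
  calc (s : ℝ) * (e / 8) + N * -(p * θ) = θ * ((1 + e / 8) * s - p * N) := by
        linear_combination -(s : ℝ) * hθw
    _ ≤ θ * -(e ^ 2 * n / 50) := by gcongr
    _ ≤ e / 9 * -(e ^ 2 * n / 50) :=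
        mul_le_mul_of_nonpos_right hθ9 (by linarith)
    _ = -(e ^ 3 / 450) * n := by ring

theorem theorem5 :
    ∃ f : ℝ → ℝ,
      (∀ ε : ℝ, 0 < ε → 0 < f ε) ∧
      (f =Θ[𝓝[>] (0 : ℝ)] fun ε : ℝ => ε ^ 2) ∧
      ∀ ε : ℝ, 0 < ε →
        ∀ (n d : ℕ → ℕ) (lam : ℕ → ℝ) (G : (k : ℕ) → SimpleGraph (Fin (n k)))
          (p : ℕ → unitInterval),
          Tendsto n atTop atTop →
          (∀ k, 0 < d k) →
          (∀ k, PseudoRandom.IsNDLambdaGraph (G k) (n k) (d k) (lam k)) →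
          (lam =o[atTop] fun k : ℕ => (d k : ℝ)) →
          (∀ᶠ k in atTop, (p k : ℝ) = (1 + ε) / (d k : ℝ)) →
          Tendsto
            (fun k : ℕ => PseudoRandom.randomSubgraph (G k) (p k)
              {H : SimpleGraph (Fin (n k)) |
                PseudoRandom.HasPathOfLength H ⌈f ε * (n k : ℝ)⌉₊})
            atTop (𝓝 1) := by
  classical
  -- A larger `ε` only helps the bounds below, so `ε` is truncated to a range where they hold.
  refine ⟨fun ε ↦ (min ε (1 / 10)) ^ 2 / 20, fun ε hε ↦ by positivity, ?_, ?_⟩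
  · have hlocal : (fun ε : ℝ ↦ (min ε (1 / 10)) ^ 2 / 20) =ᶠ[𝓝[>] 0]
        fun ε ↦ (1 / 20) * ε ^ 2 := by
      filter_upwards [nhdsWithin_le_nhds (Iio_mem_nhds (by norm_num : (0 : ℝ) < 1 / 10))]
        with ε hε
      rw [min_eq_left (le_of_lt hε)]
      ring
    exact hlocal.trans_isTheta ((isTheta_const_mul_left (by norm_num)).2 (isTheta_refl _ _))
  intro ε hε n d lam G p hn hd hG hlam hp
  set e := min ε (1 / 10) with he
  have he0 : 0 < e := by positivity
  have he1 : e ≤ 1 / 10 := min_le_right _ _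
  have hnr : Tendsto (fun k ↦ (n k : ℝ)) atTop atTop := tendsto_natCast_atTop_atTop.comp hn
  have hbound : ∀ᶠ k in atTop, 1 - Real.exp (-(e ^ 3 / 450) * n k) ≤
      (PseudoRandom.randomSubgraph (G k) (p k)).real
        {H | PseudoRandom.HasPathOfLength H ⌈e ^ 2 / 20 * (n k : ℝ)⌉₊} := by
    filter_upwards [hp, hlam.def (show 0 < e ^ 2 / 100 by positivity),
      hnr.eventually_ge_atTop (100 / e ^ 2)] with k hpk hlamk hnk
    rw [div_le_iff₀' (by positivity)] at hnk
    rw [Real.norm_eq_abs, Real.norm_natCast] at hlamk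
    have hpe : (1 + e) / d k ≤ p k := by
      rw [hpk]
      gcongr
      exact min_le_left _ _
    have hsn : ⌈(e / 2 + 3 * e ^ 2 / 8) * n k⌉₊ ≤ n k := by
      rw [Nat.ceil_le]
      exact mul_le_of_le_one_left (Nat.cast_nonneg _) (by nlinarith)
    have hbad := randomSubgraph_real_noPath_le (G k) (p k) (l := ⌈e ^ 2 / 20 * (n k : ℝ)⌉₊)
      (s := ⌈(e / 2 + 3 * e ^ 2 / 8) * n k⌉₊) (N₀ := ⌊e * d k * n k / 2⌋₊) (w := 1 + e / 8)
      (by linarith) (by rwa [(hG k).card_eq]) fun S T _ hS hT ↦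
        (hG k).lt_card_interedges he0 he1 (hd k) hlamk hnk S T hS (by rwa [(hG k).card_eq] at hT)
    have hcompl := probReal_compl_eq_one_sub (μ := PseudoRandom.randomSubgraph (G k) (p k))
      (SimpleGraph.measurableSet_of_finite
        {H | PseudoRandom.HasPathOfLength H ⌈e ^ 2 / 20 * (n k : ℝ)⌉₊})
    rw [Set.compl_ofPred] at hcompl
    linarith [pow_mul_pow_le_exp he0 he1 (hd k) (p k).2.2 hpe hnk]
  rw [← ENNReal.tendsto_toReal_iff (fun k ↦ measure_ne_top _ _) ENNReal.one_ne_top,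
    ENNReal.toReal_one]
  refine tendsto_of_tendsto_of_tendsto_of_le_of_le' ?_ tendsto_const_nhds hbound
    (.of_forall fun k ↦ measureReal_le_one)
  have hexp : Tendsto (fun k ↦ Real.exp (-(e ^ 3 / 450) * n k)) atTop (𝓝 0) :=
    Real.tendsto_exp_atBot.comp
      (hnr.const_mul_atTop_of_neg (by have := pow_pos he0 3; linarith))
  simpa using hexp.const_sub 1
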